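/- For $N\in\mathbb{N}$, $N\ge 1$, let $\mathcal{F}^{\le N}=\bigoplus_{n=0}^N L^2_s(\mathbb{R}^{3n})$ be the truncated bosonic Fock space, where $L^2_s(\mathbb{R}^{3n})$ denotes the permutation-symmetric functions $\psi(x_1,\dots,x_n)$ in $L^2((\mathbb{R}^3)^n)$, and let $\mathcal{N}$ be the number of particles operator, $(\mathcal{N}\Psi)^{(n)}=n\Psi^{(n)}$. Let $a_x^*,a_x$ ($x\in\mathbb{R}^3$) be the usual creation and annihilation operator-valued distributions, i.e. with $a^*(g)=\int g(x)\,a_x^*\,dx$ and $a(g)=\int \overline{g(x)}\,a_x\,dx$ for $g\in L^2(\mathbb{R}^3)$, \[ (a^*(g)\Psi)^{(n)}(x_1,\dots,x_n)=\frac{1}{\sqrt n}\sum_{j=1}^n g(x_j)\Psi^{(n-1)}(x_1,\dots,x_{j-1},x_{j+1},\dots,x_n), \] \[ (a(g)\Psi)^{(n)}(x_1,\dots,x_n)=\sqrt{n+1}\int \overline{g(x)}\,\Psi^{(n+1)}(x,x_1,\dots,x_n)\,dx , \] and let $b_x=\sqrt{\tfrac{N-\mathcal{N}}{N}}\,a_x$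 and $b_x^*=a_x^*\sqrt{\tfrac{N-\mathcal{N}}{N}}$. For $\eta\in L^2(\mathbb{R}^3\times\mathbb{R}^3)$ let $B(\eta)$ be the bounded antisymmetric operator on $\mathcal{F}^{\le N}$ given by \[ B(\eta)=\frac12\int\left[\eta(x;y)\,b_x^*b_y^*-\overline{\eta(x;y)}\,b_xb_y\right]dx\,dy . \] Then for all $n_1,n_2\in\mathbb{Z}$ there is a constant $C=C(n_1,n_2,\|\eta\|_2)$, depending only on $n_1$, $n_2$ and $\|\eta\|_2$ (in particular not on $N$), such that \[ e^{-B(\eta)}(\mathcal{N}+1)^{n_1}(N+1-\mathcal{N})^{n_2}e^{B(\eta)}\le C\,(\mathcal{N}+1)^{n_1}(N+1-\mathcal{N})^{n_2} \] as an operator inequality on $\mathcal{F}^{\le N}$, for every $N\ge 1$ and every $\eta\in L^2(\mathbb{R}^3\times\mathbb{R}^3)$. -/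

import Mathlib

open MeasureTheory
open scoped ENNReal ComplexConjugate

noncomputable section

namespace BogFock

/-- The one-particle configuration space `ℝ³`. -/
abbrev Pt : Type := EuclideanSpace ℝ (Fin 3)

/-- `L²(ℝ³ⁿ)`, functions of `n` points of `ℝ³`. -/
abbrev L2 (n : ℕ) : Type := Lp ℂ 2 (volume : Measure (Fin n → Pt))

/-- Integral kernels `η ∈ L²(ℝ³ × ℝ³)`. -/
abbrev Kernel : Type := Lp ℂ 2 (volume : Measure (Pt × Pt))

/-! ### Measure preserving maps of configurations -/

theorem measurePreserving_perm {n : ℕ} (σ : Equiv.Perm (Fin n)) :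
    MeasurePreserving (fun x : Fin n → Pt => fun k => x (σ k)) volume volume := by
  have := volume_measurePreserving_piCongrLeft (fun _ : Fin n => Pt) σ.symm
  have h : (fun x : Fin n → Pt => fun k => x (σ k)) =
      ⇑(MeasurableEquiv.piCongrLeft (fun _ : Fin n => Pt) σ.symm) := by
    funext x k
    have := MeasurableEquiv.piCongrLeft_apply_apply (β := fun _ : Fin n => Pt) σ.symm x (σ k)
    simpa using this.symm
  rw [h]
  exact this

/-- Split off the particles with the indices `i` and `i.succAbove j`. -/
def pick {n : ℕ} (i : Fin (n + 2)) (j : Fin (n + 1)) (x : Fin (n + 2) → Pt) :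
    (Pt × Pt) × (Fin n → Pt) :=
  ((x i, x (i.succAbove j)), fun k => x (i.succAbove (j.succAbove k)))

theorem measurePreserving_pick {n : ℕ} (i : Fin (n + 2)) (j : Fin (n + 1)) :
    MeasurePreserving (pick i j) volume volume := by
  have h1 := volume_preserving_piFinSuccAbove (fun _ : Fin (n + 2) => Pt) i
  have h2 := volume_preserving_piFinSuccAbove (fun _ : Fin (n + 1) => Pt) j
  have h3 := (MeasurePreserving.id (volume : Measure Pt)).prod h2
  have h4 := (measurePreserving_prodAssoc (volume : Measure Pt) (volume : Measure Pt)
    (volume : Measure (Fin n → Pt))).symm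
  exact h4.comp (h3.comp h1)

/-- The configuration `(y, x, z₁, …, zₙ)` made of `z = (z₁, …, zₙ)` and of the pair `p = (x, y)`. -/
def join {n : ℕ} (q : (Fin n → Pt) × (Pt × Pt)) : Fin (n + 2) → Pt :=
  Fin.cons q.2.2 (Fin.cons q.2.1 q.1)

theorem measurePreserving_join {n : ℕ} :
    MeasurePreserving (join (n := n)) volume volume := by
  have h1 := (volume_preserving_piFinSuccAbove (fun _ : Fin (n + 2) => Pt) 0).symm
  have h2 := (volume_preserving_piFinSuccAbove (fun _ : Fin (n + 1) => Pt) 0).symm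
  have h3 := (MeasurePreserving.id (volume : Measure Pt)).prod h2
  have h4 := measurePreserving_prodAssoc (volume : Measure Pt) (volume : Measure Pt)
    (volume : Measure (Fin n → Pt))
  have h5 : MeasurePreserving (Prod.map Prod.swap id :
      (Pt × Pt) × (Fin n → Pt) → (Pt × Pt) × (Fin n → Pt)) volume volume :=
    (Measure.measurePreserving_swap (μ := (volume : Measure Pt))
      (ν := (volume : Measure Pt))).prod (MeasurePreserving.id _)
  have h6 : MeasurePreserving (Prod.swap : (Fin n → Pt) × (Pt × Pt) → (Pt × Pt) × (Fin n → Pt))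
      volume volume := Measure.measurePreserving_swap
  have h := h1.comp (h3.comp (h4.comp (h5.comp h6)))
  refine (congrArg (fun f => MeasurePreserving f volume volume) ?_).mpr h
  funext q k
  refine Fin.cases ?_ (fun k => ?_) k
  · simp [join, MeasurableEquiv.piFinSuccAbove_symm_apply, MeasurableEquiv.prodAssoc]
  · simp [join, MeasurableEquiv.piFinSuccAbove_symm_apply, MeasurableEquiv.prodAssoc]

/-! ### Symmetric functions -/

/-- `L²_s(ℝ³ⁿ)`: the square integrable functions of `n` points of `ℝ³` that are invariant
under all permutations of the points. -/
def L2s (n : ℕ) : Submodule ℂ (L2 n) where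
  carrier := {ψ | ∀ σ : Equiv.Perm (Fin n), ∀ᵐ x : Fin n → Pt, ψ (fun k => x (σ k)) = ψ x}
  zero_mem' := by
    intro σ
    have h := Lp.coeFn_zero ℂ 2 (volume : Measure (Fin n → Pt))
    filter_upwards [h, (measurePreserving_perm σ).quasiMeasurePreserving.ae h] with x h1 h2
    rw [h1, h2]
    rfl
  add_mem' := by
    intro ψ φ hψ hφ σ
    have h := Lp.coeFn_add ψ φ
    filter_upwards [h, (measurePreserving_perm σ).quasiMeasurePreserving.ae h, hψ σ, hφ σ]
      with x h1 h2 h3 h4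
    rw [h1, h2, Pi.add_apply, Pi.add_apply, h3, h4]
  smul_mem' := by
    intro c ψ hψ σ
    have h := Lp.coeFn_smul c ψ
    filter_upwards [h, (measurePreserving_perm σ).quasiMeasurePreserving.ae h, hψ σ]
      with x h1 h2 h3
    rw [h1, h2, Pi.smul_apply, Pi.smul_apply, h3]

theorem mem_L2s_iff {n : ℕ} (ψ : L2 n) : ψ ∈ L2s n ↔
    ∀ σ : Equiv.Perm (Fin n), ∀ᵐ x : Fin n → Pt, ψ (fun k => x (σ k)) = ψ x := Iff.rfl

instance (n : ℕ) : CompleteSpace (L2s n) := by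
  have h : IsClosed (L2s n : Set (L2 n)) := by
    have : (L2s n : Set (L2 n)) = ⋂ σ : Equiv.Perm (Fin n),
        {ψ | Lp.compMeasurePreservingₗᵢ ℂ _ (measurePreserving_perm σ) ψ = ψ} := by
      ext ψ
      simp only [SetLike.mem_coe, Set.mem_iInter, Set.mem_ofPred_eq, mem_L2s_iff]
      refine forall_congr' fun σ => ?_
      have hc := Lp.coeFn_compMeasurePreserving ψ (measurePreserving_perm σ)
      constructor
      · intro hσ
        refine Lp.ext ?_
        filter_upwards [hc, hσ] with x h1 h2
        exact h1.trans h2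
      · intro hσ
        have hσ' : Lp.compMeasurePreserving _ (measurePreserving_perm σ) ψ = ψ := hσ
        rw [hσ'] at hc
        filter_upwards [hc] with x h1
        exact h1.symm
    rw [this]
    exact isClosed_iInter fun σ => isClosed_eq
      (Lp.compMeasurePreservingₗᵢ ℂ _ (measurePreserving_perm σ)).continuous continuous_id
  exact h.completeSpace_coe

/-! ### Creation of a pair of particles with a given kernel -/

theorem eLpNorm_tensor {n : ℕ} (η : Kernel) (ψ : L2 n) :
    eLpNorm (fun q : (Pt × Pt) × (Fin n → Pt) => η q.1 * ψ q.2) 2 volume =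
      eLpNorm η 2 volume * eLpNorm ψ 2 volume := by
  simp only [eLpNorm_eq_lintegral_rpow_enorm_toReal two_ne_zero ENNReal.ofNat_ne_top]
  rw [← ENNReal.mul_rpow_of_nonneg _ _ (by simp), Measure.volume_eq_prod,
    ← lintegral_prod_mul ((Lp.aestronglyMeasurable η).enorm.pow_const _)
      ((Lp.aestronglyMeasurable ψ).enorm.pow_const _)]
  congr 2
  funext q
  rw [enorm_mul, ENNReal.mul_rpow_of_nonneg _ _ (by simp)]

theorem aestronglyMeasurable_tensor {n : ℕ} (η : Kernel) (ψ : L2 n) :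
    AEStronglyMeasurable (fun q : (Pt × Pt) × (Fin n → Pt) => η q.1 * ψ q.2) volume :=
  (Lp.aestronglyMeasurable η).comp_fst.mul (Lp.aestronglyMeasurable ψ).comp_snd

theorem eLpNorm_pick {n : ℕ} (η : Kernel) (i : Fin (n + 2)) (j : Fin (n + 1)) (ψ : L2 n) :
    eLpNorm (fun x : Fin (n + 2) → Pt => η (x i, x (i.succAbove j)) *
      ψ (fun k => x (i.succAbove (j.succAbove k)))) 2 volume =
      eLpNorm η 2 volume * eLpNorm ψ 2 volume := by
  have h := eLpNorm_comp_measurePreserving (p := 2) (aestronglyMeasurable_tensor η ψ)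
    (measurePreserving_pick i j)
  exact h.trans (eLpNorm_tensor η ψ)

theorem memLp_pick {n : ℕ} (η : Kernel) (i : Fin (n + 2)) (j : Fin (n + 1)) (ψ : L2 n) :
    MemLp (fun x : Fin (n + 2) → Pt => η (x i, x (i.succAbove j)) *
      ψ (fun k => x (i.succAbove (j.succAbove k)))) 2 volume := by
  refine ⟨(aestronglyMeasurable_tensor η ψ).comp_measurePreserving
    (measurePreserving_pick i j), ?_⟩
  rw [eLpNorm_pick]
  exact ENNReal.mul_lt_top (Lp.eLpNorm_lt_top η) (Lp.eLpNorm_lt_top ψ)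

/-- One term of the pair creation operator: `ψ` is sent to the function
`x ↦ η(xᵢ; x_{j'}) ψ(x without xᵢ and x_{j'})`, where `j' = i.succAbove j ≠ i`. -/
def createTerm {n : ℕ} (η : Kernel) (i : Fin (n + 2)) (j : Fin (n + 1)) : L2 n →L[ℂ] L2 (n + 2) :=
  LinearMap.mkContinuous
    { toFun := fun ψ => (memLp_pick η i j ψ).toLp _
      map_add' := by
        intro ψ φ
        rw [← MemLp.toLp_add]
        refine MemLp.toLp_congr _ _ ?_
        have h := (Measure.quasiMeasurePreserving_snd (μ := (volume : Measure (Pt × Pt)))).ae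
          (Lp.coeFn_add ψ φ)
        filter_upwards [(measurePreserving_pick i j).quasiMeasurePreserving.ae h] with x hx
        simp only [pick] at hx
        simp only [hx, Pi.add_apply, mul_add]
      map_smul' := by
        intro c ψ
        rw [RingHom.id_apply, ← MemLp.toLp_const_smul]
        refine MemLp.toLp_congr _ _ ?_
        have h := (Measure.quasiMeasurePreserving_snd (μ := (volume : Measure (Pt × Pt)))).ae
          (Lp.coeFn_smul c ψ)
        filter_upwards [(measurePreserving_pick i j).quasiMeasurePreserving.ae h] with x hx
        simp only [pick] at hx
        simp only [hx, Pi.smul_apply, smul_eq_mul]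
        ring }
    ‖η‖ (by
      intro ψ
      simp only [LinearMap.coe_mk, AddHom.coe_mk]
      rw [Lp.norm_toLp, eLpNorm_pick, ENNReal.toReal_mul, Lp.norm_def, Lp.norm_def])

theorem coeFn_createTerm {n : ℕ} (η : Kernel) (i : Fin (n + 2)) (j : Fin (n + 1)) (ψ : L2 n) :
    ∀ᵐ x : Fin (n + 2) → Pt, createTerm η i j ψ x = η (x i, x (i.succAbove j)) *
      ψ (fun k => x (i.succAbove (j.succAbove k))) :=
  (memLp_pick η i j ψ).coeFn_toLp

/-- The action of `∫ η(x;y) aₓ* a_y* dx dy` from the `n`-particle to the `(n+2)`-particle sector: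
two applications of
`(a*(g)ψ)(x₁,…,xₙ) = n^{-1/2} ∑ⱼ g(xⱼ) ψ(x₁,…,xⱼ₋₁,xⱼ₊₁,…,xₙ)` give
`(n+2)^{-1/2} (n+1)^{-1/2} ∑_{i ≠ j'} η(xᵢ; x_{j'}) ψ(x without xᵢ and x_{j'})`. -/
def createL2 (η : Kernel) (n : ℕ) : L2 n →L[ℂ] L2 (n + 2) :=
  (((√(n + 2 : ℝ))⁻¹ * (√(n + 1 : ℝ))⁻¹ : ℝ) : ℂ) • ∑ i : Fin (n + 2), ∑ j : Fin (n + 1),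
    createTerm η i j

theorem coeFn_createL2 (η : Kernel) (n : ℕ) (ψ : L2 n) :
    ∀ᵐ x : Fin (n + 2) → Pt, createL2 η n ψ x =
      (((√(n + 2 : ℝ))⁻¹ * (√(n + 1 : ℝ))⁻¹ : ℝ) : ℂ) * ∑ i : Fin (n + 2), ∑ j : Fin (n + 1),
        η (x i, x (i.succAbove j)) * ψ (fun k => x (i.succAbove (j.succAbove k))) := by
  have hsum : ∀ᵐ x : Fin (n + 2) → Pt, (∑ i : Fin (n + 2), ∑ j : Fin (n + 1),
      createTerm η i j ψ) x = ∑ i : Fin (n + 2), ∑ j : Fin (n + 1), createTerm η i j ψ x := by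
    have h1 := Lp.coeFn_finsetSum (Finset.univ : Finset (Fin (n + 2)))
      (fun i => ∑ j : Fin (n + 1), createTerm η i j ψ)
    have h2 : ∀ᵐ x : Fin (n + 2) → Pt, ∀ i : Fin (n + 2),
        (∑ j : Fin (n + 1), createTerm η i j ψ) x = ∑ j : Fin (n + 1), createTerm η i j ψ x := by
      refine ae_all_iff.2 fun i => ?_
      filter_upwards [Lp.coeFn_finsetSum (Finset.univ : Finset (Fin (n + 1)))
        (fun j => createTerm η i j ψ)] with x hx
      simpa using hx
    filter_upwards [h1, h2] with x hx1 hx2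
    rw [hx1, Finset.sum_apply]
    exact Finset.sum_congr rfl fun i _ => hx2 i
  have hterm : ∀ᵐ x : Fin (n + 2) → Pt, ∀ i : Fin (n + 2), ∀ j : Fin (n + 1),
      createTerm η i j ψ x = η (x i, x (i.succAbove j)) *
        ψ (fun k => x (i.succAbove (j.succAbove k))) :=
    ae_all_iff.2 fun i => ae_all_iff.2 fun j => coeFn_createTerm η i j ψ
  have hsm := Lp.coeFn_smul (((√(n + 2 : ℝ))⁻¹ * (√(n + 1 : ℝ))⁻¹ : ℝ) : ℂ)
    (∑ i : Fin (n + 2), ∑ j : Fin (n + 1), createTerm η i j ψ)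
  filter_upwards [hsum, hterm, hsm] with x h1 h2 h3
  have : createL2 η n ψ = (((√(n + 2 : ℝ))⁻¹ * (√(n + 1 : ℝ))⁻¹ : ℝ) : ℂ) •
    (∑ i : Fin (n + 2), ∑ j : Fin (n + 1), createTerm η i j ψ) := by
    simp [createL2]
  rw [this, h3, Pi.smul_apply, h1, smul_eq_mul]
  simp only [h2]

/-- The permutation induced by `σ` on the indices that remain when `i` is removed from the
source and `σ i` from the target. -/
def restrictPerm {n : ℕ} (σ : Equiv.Perm (Fin (n + 1))) (i : Fin (n + 1)) : Equiv.Perm (Fin n) :=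
  (finSuccAboveEquiv i).trans
    ((σ.subtypeEquiv (fun a => by simp [σ.injective.ne_iff])).trans (finSuccAboveEquiv (σ i)).symm)

theorem succAbove_restrictPerm {n : ℕ} (σ : Equiv.Perm (Fin (n + 1))) (i : Fin (n + 1))
    (j : Fin n) : (σ i).succAbove (restrictPerm σ i j) = σ (i.succAbove j) := by
  have h : finSuccAboveEquiv (σ i) (restrictPerm σ i j) =
      ⟨σ (i.succAbove j), σ.injective.ne (i.succAbove_ne j)⟩ := by
    simp [restrictPerm, finSuccAboveEquiv_apply]
  exact congrArg Subtype.val h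

theorem createL2_mem {n : ℕ} (η : Kernel) (ψ : L2s n) : createL2 η n (ψ : L2 n) ∈ L2s (n + 2) := by
  intro σ
  have hc := coeFn_createL2 η n (ψ : L2 n)
  have hs : ∀ᵐ x : Fin (n + 2) → Pt, ∀ i : Fin (n + 2), ∀ j : Fin (n + 1),
      (ψ : L2 n) (fun k => x ((σ i).succAbove ((restrictPerm σ i j).succAbove
        (restrictPerm (restrictPerm σ i) j k)))) =
      (ψ : L2 n) (fun k => x ((σ i).succAbove ((restrictPerm σ i j).succAbove k))) := by
    refine ae_all_iff.2 fun i => ae_all_iff.2 fun j => ?_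
    have h := (Measure.quasiMeasurePreserving_snd (μ := (volume : Measure (Pt × Pt)))).ae
      (ψ.2 (restrictPerm (restrictPerm σ i) j))
    exact (measurePreserving_pick (σ i) (restrictPerm σ i j)).quasiMeasurePreserving.ae h
  filter_upwards [hc, (measurePreserving_perm σ).quasiMeasurePreserving.ae hc, hs] with x h1 h2 h3
  rw [h1, h2]
  congr 1
  refine (Finset.sum_congr rfl fun i _ => ?_).trans (Equiv.sum_comp σ _)
  refine (Finset.sum_congr rfl fun j _ => ?_).trans (Equiv.sum_comp (restrictPerm σ i) _)
  rw [← h3 i j]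
  simp only [succAbove_restrictPerm]

/-- `∫ η(x;y) aₓ* a_y* dx dy : L²_s(ℝ³ⁿ) → L²_s(ℝ³⁽ⁿ⁺²⁾)`. -/
def create (η : Kernel) (n : ℕ) : L2s n →L[ℂ] L2s (n + 2) :=
  ((createL2 η n).comp (L2s n).subtypeL).codRestrict (L2s (n + 2)) (fun ψ => createL2_mem η ψ)

/-! ### Annihilation of a pair of particles with a given kernel -/

theorem aestronglyMeasurable_annih {n : ℕ} (η : Kernel) (ψ : L2 (n + 2)) :
    AEStronglyMeasurable (fun q : (Fin n → Pt) × (Pt × Pt) => conj (η q.2) * ψ (join q)) volume :=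
  (Complex.continuous_conj.comp_aestronglyMeasurable
    (Lp.aestronglyMeasurable η).comp_snd).mul
    ((Lp.aestronglyMeasurable ψ).comp_measurePreserving measurePreserving_join)

theorem lintegral_join {n : ℕ} (ψ : L2 (n + 2)) :
    ∫⁻ z : Fin n → Pt, ∫⁻ p : Pt × Pt, ‖ψ (join (z, p))‖ₑ ^ (2 : ℝ) =
      eLpNorm ψ 2 volume ^ (2 : ℝ) := by
  have hm : AEMeasurable (fun q : (Fin n → Pt) × (Pt × Pt) => ‖ψ (join q)‖ₑ ^ (2 : ℝ)) volume :=
    ((Lp.aestronglyMeasurable ψ).comp_measurePreserving measurePreserving_join).enorm.pow_const _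
  rw [← lintegral_prod _ hm, ← Measure.volume_eq_prod]
  have h := eLpNorm_comp_measurePreserving (p := 2) (Lp.aestronglyMeasurable ψ)
    (measurePreserving_join (n := n))
  rw [← h, eLpNorm_eq_lintegral_rpow_enorm_toReal two_ne_zero ENNReal.ofNat_ne_top,
    ← ENNReal.rpow_mul]
  simp

theorem ae_memLp_join {n : ℕ} (ψ : L2 (n + 2)) :
    ∀ᵐ z : Fin n → Pt, MemLp (fun p : Pt × Pt => ψ (join (z, p))) 2 volume := by
  have hm : AEStronglyMeasurable (fun q : (Fin n → Pt) × (Pt × Pt) => ψ (join q)) volume :=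
    (Lp.aestronglyMeasurable ψ).comp_measurePreserving measurePreserving_join
  have h1 := AEStronglyMeasurable.prodMk_left hm
  have hfin : ∫⁻ z : Fin n → Pt, ∫⁻ p : Pt × Pt, ‖ψ (join (z, p))‖ₑ ^ (2 : ℝ) ≠ ∞ := by
    rw [lintegral_join]
    exact ENNReal.rpow_ne_top_of_nonneg (by simp) (Lp.eLpNorm_ne_top ψ)
  have h2 := ae_lt_top' ((hm.enorm.pow_const (2 : ℝ)).lintegral_prod_right') hfin
  filter_upwards [h1, h2] with z hz1 hz2
  refine ⟨hz1, ?_⟩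
  rw [eLpNorm_eq_lintegral_rpow_enorm_toReal two_ne_zero ENNReal.ofNat_ne_top]
  exact ENNReal.rpow_lt_top_of_nonneg (by simp) (by simpa using hz2.ne)

theorem ae_integrable_annih {n : ℕ} (η : Kernel) (ψ : L2 (n + 2)) :
    ∀ᵐ z : Fin n → Pt, Integrable (fun p : Pt × Pt => conj (η p) * ψ (join (z, p))) volume := by
  filter_upwards [ae_memLp_join ψ] with z hz
  exact MemLp.integrable_mul (p := 2) (q := 2) (Lp.memLp η).star hz

theorem eLpNorm_annih_le {n : ℕ} (η : Kernel) (ψ : L2 (n + 2)) :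
    eLpNorm (fun z : Fin n → Pt => ∫ p : Pt × Pt, conj (η p) * ψ (join (z, p))) 2 volume ≤
      eLpNorm η 2 volume * eLpNorm ψ 2 volume := by
  have key : ∀ᵐ z : Fin n → Pt, ‖∫ p : Pt × Pt, conj (η p) * ψ (join (z, p))‖ₑ ^ (2 : ℝ) ≤
      eLpNorm η 2 volume ^ (2 : ℝ) * ∫⁻ p : Pt × Pt, ‖ψ (join (z, p))‖ₑ ^ (2 : ℝ) := by
    filter_upwards [ae_memLp_join ψ] with z hz
    have h1 : ‖∫ p : Pt × Pt, conj (η p) * ψ (join (z, p))‖ₑ ≤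
        (∫⁻ p : Pt × Pt, ‖η p‖ₑ ^ (2 : ℝ)) ^ (1 / (2 : ℝ)) *
          (∫⁻ p : Pt × Pt, ‖ψ (join (z, p))‖ₑ ^ (2 : ℝ)) ^ (1 / (2 : ℝ)) := by
      refine (enorm_integral_le_lintegral_enorm _).trans ?_
      refine le_trans (le_of_eq ?_) (ENNReal.lintegral_mul_le_Lp_mul_Lq volume
        Real.HolderConjugate.two_two (Lp.aestronglyMeasurable η).enorm
        hz.aestronglyMeasurable.enorm)
      refine lintegral_congr fun p => ?_
      simp [enorm_mul]
    refine (ENNReal.rpow_le_rpow h1 (by norm_num)).trans (le_of_eq ?_)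
    rw [ENNReal.mul_rpow_of_nonneg _ _ (by norm_num),
      eLpNorm_eq_lintegral_rpow_enorm_toReal two_ne_zero ENNReal.ofNat_ne_top, ← ENNReal.rpow_mul,
      ← ENNReal.rpow_mul, ← ENNReal.rpow_mul]
    simp
  rw [eLpNorm_eq_lintegral_rpow_enorm_toReal two_ne_zero ENNReal.ofNat_ne_top]
  have h2 : ∫⁻ z : Fin n → Pt, ‖∫ p : Pt × Pt, conj (η p) * ψ (join (z, p))‖ₑ ^ (2 : ℝ) ≤
      (eLpNorm η 2 volume * eLpNorm ψ 2 volume) ^ (2 : ℝ) := by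
    refine (lintegral_mono_ae key).trans (le_of_eq ?_)
    rw [lintegral_const_mul' _ _
      (ENNReal.rpow_ne_top_of_nonneg (by norm_num) (Lp.eLpNorm_ne_top η)), lintegral_join,
      ENNReal.mul_rpow_of_nonneg _ _ (by norm_num)]
  have h3 := ENNReal.rpow_le_rpow h2 (z := 1 / 2) (by norm_num)
  rw [← ENNReal.rpow_mul] at h3
  simpa using h3

theorem memLp_annih {n : ℕ} (η : Kernel) (ψ : L2 (n + 2)) :
    MemLp (fun z : Fin n → Pt => ∫ p : Pt × Pt, conj (η p) * ψ (join (z, p))) 2 volume :=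
  ⟨(aestronglyMeasurable_annih η ψ).integral_prod_right',
    (eLpNorm_annih_le η ψ).trans_lt (ENNReal.mul_lt_top (Lp.eLpNorm_lt_top η)
      (Lp.eLpNorm_lt_top ψ))⟩

/-- The map that sends `ψ` to the function
`z ↦ ∫ conj η(x;y) ψ(y, x, z₁, …, zₙ) dx dy`. -/
def contractL2 (η : Kernel) (n : ℕ) : L2 (n + 2) →L[ℂ] L2 n :=
  LinearMap.mkContinuous
    { toFun := fun ψ => (memLp_annih η ψ).toLp _
      map_add' := by
        intro ψ φ
        rw [← MemLp.toLp_add]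
        refine MemLp.toLp_congr _ _ ?_
        have h := Measure.ae_ae_of_ae_prod
          ((measurePreserving_join (n := n)).quasiMeasurePreserving.ae (Lp.coeFn_add ψ φ))
        filter_upwards [h, ae_integrable_annih η ψ, ae_integrable_annih η φ] with z h1 h2 h3
        rw [Pi.add_apply, ← integral_add h2 h3]
        refine integral_congr_ae ?_
        filter_upwards [h1] with p hp
        simp only [hp, Pi.add_apply, mul_add]
      map_smul' := by
        intro c ψ
        rw [RingHom.id_apply, ← MemLp.toLp_const_smul]
        refine MemLp.toLp_congr _ _ ?_
        have h := Measure.ae_ae_of_ae_prod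
          ((measurePreserving_join (n := n)).quasiMeasurePreserving.ae (Lp.coeFn_smul c ψ))
        filter_upwards [h] with z h1
        rw [Pi.smul_apply, smul_eq_mul, ← integral_const_mul]
        refine integral_congr_ae ?_
        filter_upwards [h1] with p hp
        simp only [hp, Pi.smul_apply, smul_eq_mul]
        ring }
    ‖η‖ (by
      intro ψ
      simp only [LinearMap.coe_mk, AddHom.coe_mk]
      rw [Lp.norm_toLp, Lp.norm_def, Lp.norm_def, ← ENNReal.toReal_mul]
      exact ENNReal.toReal_mono (ENNReal.mul_ne_top (Lp.eLpNorm_ne_top η) (Lp.eLpNorm_ne_top ψ))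
        (eLpNorm_annih_le η ψ))

theorem coeFn_contractL2 (η : Kernel) (n : ℕ) (ψ : L2 (n + 2)) :
    ∀ᵐ z : Fin n → Pt, contractL2 η n ψ z = ∫ p : Pt × Pt, conj (η p) * ψ (join (z, p)) :=
  (memLp_annih η ψ).coeFn_toLp

theorem contractL2_mem {n : ℕ} (η : Kernel) (ψ : L2s (n + 2)) :
    contractL2 η n (ψ : L2 (n + 2)) ∈ L2s n := by
  intro σ
  set τ : Equiv.Perm (Fin (n + 2)) :=
    Equiv.Perm.decomposeFin.symm (0, Equiv.Perm.decomposeFin.symm (0, σ)) with hτ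
  have hc := coeFn_contractL2 η n (ψ : L2 (n + 2))
  have hs := Measure.ae_ae_of_ae_prod
    ((measurePreserving_join (n := n)).quasiMeasurePreserving.ae (ψ.2 τ))
  have hj : ∀ (z : Fin n → Pt) (p : Pt × Pt),
      (fun k => join (z, p) (τ k)) = join (fun k => z (σ k), p) := by
    intro z p
    funext k
    refine Fin.cases ?_ (fun k => ?_) k
    · simp [hτ, join, -Equiv.Perm.decomposeFin_symm_of_refl]
    · refine Fin.cases ?_ (fun k => ?_) k
      · simp [hτ, join]
      · simp [hτ, join, Equiv.Perm.decomposeFin_symm_apply_succ]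
  filter_upwards [hc, (measurePreserving_perm σ).quasiMeasurePreserving.ae hc, hs] with z h1 h2 h3
  rw [h1, h2]
  refine integral_congr_ae ?_
  filter_upwards [h3] with p hp
  rw [hj] at hp
  simp only [hp]

/-- The action of `∫ conj η(x;y) aₓ a_y dx dy` from the `(n+2)`-particle to the `n`-particle
sector: two applications of
`(a(g)ψ)(x₁,…,xₙ) = (n+1)^{1/2} ∫ conj g(x) ψ(x,x₁,…,xₙ) dx` give
`(n+1)^{1/2} (n+2)^{1/2} ∫ conj η(x;y) ψ(y,x,z₁,…,zₙ) dx dy`. -/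
def annihilate (η : Kernel) (n : ℕ) : L2s (n + 2) →L[ℂ] L2s n :=
  ((√(n + 1 : ℝ) * √(n + 2 : ℝ) : ℝ) : ℂ) •
    ((contractL2 η n).comp (L2s (n + 2)).subtypeL).codRestrict (L2s n)
      (fun ψ => contractL2_mem η ψ)

/-! ### The truncated Fock space and its operators -/

/-- The bosonic Fock space `F^{≤N} = ⨁_{n=0}^N L²_s(ℝ³ⁿ)` with at most `N` particles,
a Hilbert space direct sum. -/
abbrev FockLE (N : ℕ) : Type := PiLp 2 (fun n : Fin (N + 1) => L2s (n : ℕ))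

/-- The bounded operators on `F^{≤N}`. -/
abbrev Op (N : ℕ) : Type := FockLE N →L[ℂ] FockLE N

/- Mathlib's own instances, named here so that instance search finds them quickly. -/

instance (N : ℕ) : NormedAddCommGroup (FockLE N) := PiLp.normedAddCommGroup _ _

instance (N : ℕ) : InnerProductSpace ℂ (FockLE N) := PiLp.innerProductSpace _

instance (N : ℕ) : CompleteSpace (FockLE N) := inferInstance

instance (N : ℕ) : NormedRing (Op N) := ContinuousLinearMap.toNormedRing

instance (N : ℕ) : NormedAlgebra ℂ (Op N) := ContinuousLinearMap.toNormedAlgebra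

/-- The Loewner order: `A ≤ A'` if `A' - A` is a positive operator. -/
instance (N : ℕ) : PartialOrder (Op N) := ContinuousLinearMap.instLoewnerPartialOrder

/-- The operator on `F^{≤N}` with the given components. -/
def ofComponents {N : ℕ} (A : ∀ n : Fin (N + 1), FockLE N →L[ℂ] L2s (n : ℕ)) : Op N :=
  ((PiLp.continuousLinearEquiv 2 ℂ (fun n : Fin (N + 1) => L2s (n : ℕ))).symm :
    (∀ n : Fin (N + 1), L2s (n : ℕ)) →L[ℂ] FockLE N).comp (ContinuousLinearMap.pi A)

/-- The projection on the `n`-particle sector, `n ≤ N`. -/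
def sector {N : ℕ} (n : ℕ) (hn : n ≤ N) : FockLE N →L[ℂ] L2s n :=
  PiLp.proj 2 (fun n : Fin (N + 1) => L2s (n : ℕ)) (⟨n, Nat.lt_succ_of_le hn⟩ : Fin (N + 1))

/-- The function `f(𝒩)` of the number of particles operator `𝒩`: multiplication by `f n` on the
`n`-particle sector. In particular `𝒩` itself is `(𝒩Ψ)⁽ⁿ⁾ = n Ψ⁽ⁿ⁾`. -/
def numFn (N : ℕ) (f : ℕ → ℝ) : Op N :=
  ofComponents fun n => ((f n : ℝ) : ℂ) • sector (n : ℕ) (Nat.le_of_lt_succ n.2)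

/-- The components of `∫ η(x;y) bₓ* b_y* dx dy`, where `bₓ* = aₓ* ((N-𝒩)/N)^{1/2}`. On the
`n`-particle sector the right factor `((N-𝒩)/N)^{1/2}` is `((N-n)/N)^{1/2}` and the left one,
which acts after `a_y*`, is `((N-(n+1))/N)^{1/2}`. -/
def pairCreateComponent {N : ℕ} (η : Kernel) : ∀ n : ℕ, n ≤ N → (FockLE N →L[ℂ] L2s n)
  | 0, _ => 0
  | 1, _ => 0
  | n + 2, hn =>
    ((√((N - (n + 1) : ℝ) / N) * √((N - n : ℝ) / N) : ℝ) : ℂ) •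
      (create η n).comp (sector n (by omega))

/-- `∫ η(x;y) bₓ* b_y* dx dy` on `F^{≤N}`. -/
def pairCreate (N : ℕ) (η : Kernel) : Op N :=
  ofComponents fun n => pairCreateComponent η (n : ℕ) (Nat.le_of_lt_succ n.2)

/-- The components of `∫ conj η(x;y) bₓ b_y dx dy`, where `bₓ = ((N-𝒩)/N)^{1/2} aₓ`. In the
`n`-particle component of the result the left factor `((N-𝒩)/N)^{1/2}` is `((N-n)/N)^{1/2}`, and
the right one, which acts between `a_y` and `aₓ`, is `((N-(n+1))/N)^{1/2}`. For `n + 2 > N` there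
is no `(n+2)`-particle component to act on. -/
def pairAnnihilateComponent {N : ℕ} (η : Kernel) (n : ℕ) : FockLE N →L[ℂ] L2s n :=
  if hn : n + 2 ≤ N then
    ((√((N - n : ℝ) / N) * √((N - (n + 1) : ℝ) / N) : ℝ) : ℂ) •
      (annihilate η n).comp (sector (n + 2) hn)
  else 0

/-- `∫ conj η(x;y) bₓ b_y dx dy` on `F^{≤N}`. -/
def pairAnnihilate (N : ℕ) (η : Kernel) : Op N :=
  ofComponents fun n => pairAnnihilateComponent η (n : ℕ)

/-- `B(η) = ½ ∫ [η(x;y) bₓ* b_y* - conj η(x;y) bₓ b_y] dx dy` on `F^{≤N}`. -/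
def bogB (N : ℕ) (η : Kernel) : Op N :=
  (1 / 2 : ℂ) • (pairCreate N η - pairAnnihilate N η)

/-- `(𝒩+1)^{n₁} (N+1-𝒩)^{n₂}` on `F^{≤N}`; both factors are invertible functions of `𝒩`. -/
def numWeight (N : ℕ) (n₁ n₂ : ℤ) : Op N :=
  numFn N (fun n => ((n : ℝ) + 1) ^ n₁) * numFn N (fun n => ((N : ℝ) + 1 - n) ^ n₂)

end BogFock

end

/-!
The weight `W = (𝒩+1)^{n₁} (N+1-𝒩)^{n₂}` is multiplication by `w(n) = (n+1)^{n₁} (N+1-n)^{n₂}` on the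
`n`-particle sector, and `B = B(η)` is antisymmetric, because on symmetric functions pair
annihilation is the adjoint of pair creation (`inner_create_left`). For `u(s) = e^{sB} Ψ` the function
`f(s) = ⟨u(s), W u(s)⟩` therefore has the derivative `f' = ⟨u, [W, B] u⟩`, and the claim follows by
Grönwall's inequality from `⟨u, [W, B] u⟩ ≤ K ‖η‖ ⟨u, W u⟩` with `K` independent of `N`
(`conj_exp_le_of_re_inner_le`, with the constant `C = exp (K ‖η‖)`).

For this commutator bound, `⟨u, [W, B] u⟩` is a sum over `n ≤ N - 2` of the differences `w(n+2) - w(n)`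
times matrix elements of pair creation between the sectors `n` and `n + 2`
(`two_mul_re_inner_bogB`). By the triangle inequality (`norm_create_le`) pair creation has norm at
most `√((n+1)(n+2)) √((N-n)(N-n-1)) ‖η‖ / N = O((n+1)(N-n-1)/N) ‖η‖` there, where the second root comes
from the truncation in `bₓ*`. On the other hand `w(n+2)/w(n)` differs from `1` by
`O(1/(n+1) + 1/(N-n-1)) = O(N/((n+1)(N-n-1)))`. The product is bounded by a constant times `w(n)`, and
likewise by a constant times `w(n+2)` (`exists_abs_weight_sub_mul_pairBound_le`), and
`2‖u_n‖‖u_{n+2}‖ ≤ ‖u_n‖² + ‖u_{n+2}‖²` turns the sum into a multiple of `⟨u, W u⟩ = ∑ w(n) ‖u_n‖²`.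
-/

open MeasureTheory
open scoped ENNReal ComplexConjugate

noncomputable section

namespace BogFock

/-! ### Variation of the weights -/

theorem exists_abs_zpow_sub_one_le (k : ℤ) :
    ∃ K : ℝ, 0 ≤ K ∧ ∀ x : ℝ, 1 ≤ x → x ≤ 3 → |x ^ k - 1| ≤ K * (x - 1) := by
  induction k using Int.induction_on with
  | zero => exact ⟨0, le_rfl, fun x _ _ => by simp⟩
  | succ k ih =>
    obtain ⟨K, hK, h⟩ := ih
    refine ⟨3 * K + 1, by positivity, fun x h1 h3 => ?_⟩
    have e : x ^ ((k : ℤ) + 1) - 1 = x * (x ^ (k : ℤ) - 1) + (x - 1) := by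
      rw [zpow_add_one₀ (by positivity)]; ring
    have hx := h x h1 h3
    rw [e]
    calc _ ≤ |x * (x ^ (k : ℤ) - 1)| + |x - 1| := abs_add_le _ _
      _ = x * |x ^ (k : ℤ) - 1| + (x - 1) := by
        rw [abs_mul, abs_of_nonneg (by positivity : 0 ≤ x), abs_of_nonneg (sub_nonneg.2 h1)]
      _ ≤ 3 * (K * (x - 1)) + (x - 1) := by gcongr
      _ = _ := by ring
  | pred k ih =>
    obtain ⟨K, hK, h⟩ := ih
    refine ⟨K + 1, by positivity, fun x h1 h3 => ?_⟩
    have e : x ^ (-(k : ℤ) - 1) - 1 = x⁻¹ * ((x ^ (-(k : ℤ)) - 1) - (x - 1)) := by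
      rw [zpow_sub_one₀ (by positivity)]
      have : x ≠ 0 := by positivity
      field_simp
      ring
    have hx := h x h1 h3
    rw [e, abs_mul, abs_of_nonneg (by positivity : 0 ≤ x⁻¹)]
    calc _ ≤ 1 * (|x ^ (-(k : ℤ)) - 1| + |x - 1|) := by
          gcongr
          · exact inv_le_one_of_one_le₀ h1
          · exact abs_sub _ _
      _ ≤ 1 * (K * (x - 1) + (x - 1)) := by
          rw [abs_of_nonneg (sub_nonneg.2 h1)]; gcongr
      _ = _ := by ring

theorem exists_abs_zpow_mul_zpow_sub_one_le (k l : ℤ) :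
    ∃ K : ℝ, 0 ≤ K ∧ ∀ x y : ℝ, 1 ≤ x → x ≤ 3 → 1 ≤ y → y ≤ 3 →
      |x ^ k * y ^ l - 1| ≤ K * ((x - 1) + (y - 1)) := by
  obtain ⟨K, hK, h⟩ := exists_abs_zpow_sub_one_le k
  obtain ⟨L, hL, h'⟩ := exists_abs_zpow_sub_one_le l
  refine ⟨K + (1 + 2 * K) * L, by positivity, fun x y hx1 hx3 hy1 hy3 => ?_⟩
  have hx := h x hx1 hx3
  have hy := h' y hy1 hy3
  have hxk : |x ^ k| ≤ 1 + 2 * K := by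
    have : |x ^ k| ≤ |x ^ k - 1| + |(1 : ℝ)| := by simpa using abs_add_le (x ^ k - 1) 1
    have h2 : K * (x - 1) ≤ K * 2 := by gcongr; linarith
    rw [abs_one] at this
    linarith
  have e : x ^ k * y ^ l - 1 = x ^ k * (y ^ l - 1) + (x ^ k - 1) := by ring
  have hx0 : 0 ≤ x - 1 := by linarith
  have hy0 : 0 ≤ y - 1 := by linarith
  rw [e]
  calc _ ≤ |x ^ k * (y ^ l - 1)| + |x ^ k - 1| := abs_add_le _ _
    _ ≤ (1 + 2 * K) * (L * (y - 1)) + K * (x - 1) := by rw [abs_mul]; gcongr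
    _ ≤ (1 + 2 * K) * (L * (y - 1)) + K * (x - 1) + ((1 + 2 * K) * L * (x - 1) + K * (y - 1)) :=
        le_add_of_nonneg_right (by positivity)
    _ = _ := by ring

/-- The eigenvalue of `(𝒩+1)^{n₁} (N+1-𝒩)^{n₂}` on the `n`-particle sector. -/
def weight (N : ℕ) (n₁ n₂ : ℤ) (n : ℕ) : ℝ := ((n : ℝ) + 1) ^ n₁ * ((N : ℝ) + 1 - n) ^ n₂

theorem weight_pos {N n : ℕ} (n₁ n₂ : ℤ) (hn : n ≤ N) : 0 < weight N n₁ n₂ n := by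
  have h : (n : ℝ) ≤ N := by exact_mod_cast hn
  have h1 : (0 : ℝ) < (N : ℝ) + 1 - n := by linarith
  exact mul_pos (zpow_pos (by positivity) _) (zpow_pos h1 _)

/-- The factor that `bₓ* b_y*` carries, compared with `aₓ* a_y*`, on the `n`-particle sector. -/
def truncFactor (N n : ℕ) : ℝ := √((N - (n + 1) : ℝ) / N) * √((N - n : ℝ) / N)

theorem truncFactor_nonneg (N n : ℕ) : 0 ≤ truncFactor N n := by
  unfold truncFactor; positivity

/-- The bound, up to the factor `‖η‖`, for the norm of `∫ η(x;y) bₓ* b_y* dx dy` on the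
`n`-particle sector. -/
def pairBound (N n : ℕ) : ℝ := truncFactor N n * (√(n + 2 : ℝ) * √(n + 1 : ℝ))

theorem pairBound_nonneg (N n : ℕ) : 0 ≤ pairBound N n :=
  mul_nonneg (truncFactor_nonneg N n) (by positivity)

theorem pairBound_le {N n : ℕ} (hn : n + 2 ≤ N) :
    pairBound N n ≤ 2 * (n + 1) * (N - 1 - n) / N := by
  have h : (n : ℝ) + 2 ≤ N := by exact_mod_cast hn
  have hN : (0 : ℝ) < N := by have : (0 : ℝ) ≤ n := by positivity
                              linarith
  have h1 : (0 : ℝ) ≤ N - (n + 1) := by linarith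
  have h2 : (0 : ℝ) ≤ N - n := by linarith
  unfold pairBound truncFactor
  rw [← Real.sqrt_mul (by positivity), ← Real.sqrt_mul (by positivity),
    ← Real.sqrt_mul (by positivity)]
  refine Real.sqrt_le_iff.2 ⟨?_, ?_⟩
  · have : (0 : ℝ) ≤ N - 1 - n := by linarith
    positivity
  · have e1 : (N - (n + 1) : ℝ) / N * ((N - n) / N) * ((n + 2) * (n + 1)) =
      ((N - (n + 1)) * (N - n) * ((n + 2) * (n + 1))) / N ^ 2 := by field_simp
    have e2 : (2 * (n + 1) * (N - 1 - n) / N : ℝ) ^ 2 =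
      ((N - (n + 1)) * (2 * (N - (n + 1))) * ((2 * (n + 1)) * (n + 1))) / N ^ 2 := by
      field_simp; ring
    rw [e1, e2]
    gcongr <;> linarith

/-- The ratio of the weights two sectors apart differs from `1` by `O(1/(n+1) + 1/(N-n-1))`,
while the norm of the pair creation operator is `O((n+1)(N-n-1)/N)`. The product is bounded
uniformly in `N`. -/
theorem exists_abs_weight_sub_mul_pairBound_le (n₁ n₂ : ℤ) :
    ∃ K : ℝ, 0 ≤ K ∧ ∀ N n : ℕ, n + 2 ≤ N →
      |weight N n₁ n₂ (n + 2) - weight N n₁ n₂ n| * pairBound N n ≤ K * weight N n₁ n₂ n ∧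
      |weight N n₁ n₂ (n + 2) - weight N n₁ n₂ n| * pairBound N n ≤
        K * weight N n₁ n₂ (n + 2) := by
  obtain ⟨K, hK, h⟩ := exists_abs_zpow_mul_zpow_sub_one_le n₁ (-n₂)
  obtain ⟨L, hL, h'⟩ := exists_abs_zpow_mul_zpow_sub_one_le (-n₁) n₂
  refine ⟨4 * max K L, by positivity, fun N n hn => ?_⟩
  have hw := weight_pos n₁ n₂ (show n ≤ N by omega)
  have hw' := weight_pos n₁ n₂ hn
  have hn' : (n : ℝ) + 2 ≤ N := by exact_mod_cast hn
  have hn0 : (0 : ℝ) ≤ n := by positivity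
  have ha : (0 : ℝ) < n + 1 := by positivity
  have hb : (1 : ℝ) ≤ N - 1 - n := by linarith
  have hN : (0 : ℝ) < N := by linarith
  -- The ratios of the two factors of the weight; both lie in `[1, 3]` since `n + 2 ≤ N`.
  set x : ℝ := (n + 3) / (n + 1) with hx
  set y : ℝ := (N + 1 - n) / (N - 1 - n) with hy
  have hx1 : 1 ≤ x := by rw [hx, one_le_div ha]; linarith
  have hx3 : x ≤ 3 := by rw [hx, div_le_iff₀ ha]; linarith
  have hy1 : 1 ≤ y := by rw [hy, one_le_div (by linarith)]; linarith
  have hy3 : y ≤ 3 := by rw [hy, div_le_iff₀ (by linarith)]; linarith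
  have hsum : (x - 1) + (y - 1) = 2 * N / ((n + 1) * (N - 1 - n)) := by
    have : (N - 1 - n : ℝ) ≠ 0 := by linarith
    rw [hx, hy]; field_simp; ring
  have hprod : ((x - 1) + (y - 1)) * pairBound N n ≤ 4 := by
    have hs : 0 ≤ (x - 1) + (y - 1) := by linarith
    calc _ ≤ ((x - 1) + (y - 1)) * (2 * (n + 1) * (N - 1 - n) / N) := by
          gcongr; exact pairBound_le hn
      _ = 4 := by
          have : (N - 1 - n : ℝ) ≠ 0 := by linarith
          rw [hsum]; field_simp; norm_num
  have hN1 : (N : ℝ) + 1 - n ≠ 0 := by linarith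
  have hN2 : (N : ℝ) - 1 - n ≠ 0 := by linarith
  have hr : weight N n₁ n₂ (n + 2) = x ^ n₁ * y ^ (-n₂) * weight N n₁ n₂ n := by
    have e1 : ((n + 2 : ℕ) : ℝ) + 1 = x * (n + 1) := by
      rw [hx]; push_cast; field_simp; ring
    have e2 : (N : ℝ) + 1 - ((n + 2 : ℕ) : ℝ) = y⁻¹ * (N + 1 - n) := by
      rw [hy]; push_cast; field_simp; ring
    unfold weight
    rw [e1, e2, mul_zpow, mul_zpow, inv_zpow']
    ring
  have hr' : weight N n₁ n₂ n = x ^ (-n₁) * y ^ n₂ * weight N n₁ n₂ (n + 2) := by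
    have hx0 : x ^ n₁ ≠ 0 := zpow_ne_zero _ (by positivity)
    have hy0 : y ^ n₂ ≠ 0 := zpow_ne_zero _ (by positivity)
    rw [hr, zpow_neg, zpow_neg]
    field_simp
  have hp := pairBound_nonneg N n
  constructor
  · have e : weight N n₁ n₂ (n + 2) - weight N n₁ n₂ n =
        (x ^ n₁ * y ^ (-n₂) - 1) * weight N n₁ n₂ n := by rw [hr]; ring
    rw [e, abs_mul, abs_of_pos hw]
    calc _ ≤ (K * ((x - 1) + (y - 1))) * weight N n₁ n₂ n * pairBound N n := by
          gcongr; exact h x y hx1 hx3 hy1 hy3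
      _ = K * (((x - 1) + (y - 1)) * pairBound N n) * weight N n₁ n₂ n := by ring
      _ ≤ max K L * 4 * weight N n₁ n₂ n := by
          gcongr; exact le_max_left _ _
      _ = _ := by ring
  · have e : weight N n₁ n₂ (n + 2) - weight N n₁ n₂ n =
        -((x ^ (-n₁) * y ^ n₂ - 1) * weight N n₁ n₂ (n + 2)) := by
      rw [sub_mul, ← hr']; ring
    rw [e, abs_neg, abs_mul, abs_of_pos hw']
    calc _ ≤ (L * ((x - 1) + (y - 1))) * weight N n₁ n₂ (n + 2) * pairBound N n := by
          gcongr; exact h' x y hx1 hx3 hy1 hy3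
      _ = L * (((x - 1) + (y - 1)) * pairBound N n) * weight N n₁ n₂ (n + 2) := by ring
      _ ≤ max K L * 4 * weight N n₁ n₂ (n + 2) := by
          gcongr; exact le_max_right _ _
      _ = _ := by ring

/-! ### Pair creation: norm bound and adjoint -/

/-- The triangle inequality for the `(n+2)(n+1)` terms, each of norm at most `‖η‖ ‖ψ‖`. -/
theorem norm_createL2_le (η : Kernel) (n : ℕ) (ψ : L2 n) :
    ‖createL2 η n ψ‖ ≤ √(n + 2 : ℝ) * √(n + 1 : ℝ) * ‖η‖ * ‖ψ‖ := by
  have hterm : ∀ (i : Fin (n + 2)) (j : Fin (n + 1)), ‖createTerm η i j ψ‖ ≤ ‖η‖ * ‖ψ‖ :=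
    fun i j => ContinuousLinearMap.le_of_opNorm_le _
      (LinearMap.mkContinuous_norm_le _ (norm_nonneg η) _) ψ
  have hsum : ‖∑ i : Fin (n + 2), ∑ j : Fin (n + 1), createTerm η i j ψ‖ ≤
      ((n + 2) * (n + 1) : ℝ) * (‖η‖ * ‖ψ‖) := by
    refine (norm_sum_le_of_le _ fun i _ => norm_sum_le_of_le _ fun j _ => hterm i j).trans ?_
    simp only [Finset.sum_const, Finset.card_univ, Fintype.card_fin, nsmul_eq_mul]
    push_cast
    exact (mul_assoc _ _ _).ge
  have e : createL2 η n ψ = (((√(n + 2 : ℝ))⁻¹ * (√(n + 1 : ℝ))⁻¹ : ℝ) : ℂ) •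
    (∑ i : Fin (n + 2), ∑ j : Fin (n + 1), createTerm η i j ψ) := by
      simp [createL2]
  have h2 : (√(n + 2 : ℝ)) * √(n + 2 : ℝ) = n + 2 := Real.mul_self_sqrt (by positivity)
  have h1 : (√(n + 1 : ℝ)) * √(n + 1 : ℝ) = n + 1 := Real.mul_self_sqrt (by positivity)
  have p2 : 0 < √(n + 2 : ℝ) := by positivity
  have p1 : 0 < √(n + 1 : ℝ) := by positivity
  rw [e, norm_smul, Complex.norm_real, Real.norm_of_nonneg (by positivity)]
  calc _ ≤ ((√(n + 2 : ℝ))⁻¹ * (√(n + 1 : ℝ))⁻¹) * (((n + 2) * (n + 1) : ℝ) * (‖η‖ * ‖ψ‖)) := by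
        gcongr
    _ = ((√(n + 2 : ℝ))⁻¹ * (√(n + 1 : ℝ))⁻¹) * ((((√(n + 2 : ℝ)) * √(n + 2 : ℝ)) *
          ((√(n + 1 : ℝ)) * √(n + 1 : ℝ))) * (‖η‖ * ‖ψ‖)) := by rw [h2, h1]
    _ = _ := by field_simp

theorem norm_create_le (η : Kernel) (n : ℕ) (ψ : L2s n) :
    ‖create η n ψ‖ ≤ √(n + 2 : ℝ) * √(n + 1 : ℝ) * ‖η‖ * ‖ψ‖ :=
  norm_createL2_le η n (ψ : L2 n)

theorem pick_one_zero {n : ℕ} (x : Fin (n + 2) → Pt) :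
    pick 1 0 x = ((x 1, x 0), fun k => x k.succ.succ) := by
  have h1 : (1 : Fin (n + 2)) = Fin.succ 0 := rfl
  have h10 : (1 : Fin (n + 2)).succAbove 0 = 0 := by simp
  have h1k : ∀ k : Fin n, (1 : Fin (n + 2)).succAbove ((0 : Fin (n + 1)).succAbove k) =
      k.succ.succ := by
    intro k
    rw [Fin.succAbove_zero, h1, Fin.succ_succAbove_succ, Fin.succAbove_zero]
  simp only [pick, h10, h1k]

/-- A permutation that moves the particles `i` and `i.succAbove j` to the places `1` and `0`
and keeps the others in order. -/
theorem exists_perm_pick {n : ℕ} (i : Fin (n + 2)) (j : Fin (n + 1)) :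
    ∃ σ : Equiv.Perm (Fin (n + 2)), ∀ x : Fin (n + 2) → Pt,
      pick 1 0 (fun k => x (σ k)) = pick i j x := by
  set f : Fin (n + 2) → Fin (n + 2) :=
    Fin.cons (i.succAbove j) (Fin.cons i fun k => i.succAbove (j.succAbove k)) with hf
  have hinj : Function.Injective f := by
    rw [hf, Fin.cons_injective_iff, Fin.cons_injective_iff]
    refine ⟨?_, ?_, i.succAbove_right_injective.comp j.succAbove_right_injective⟩
    · rintro ⟨k, hk⟩
      refine Fin.cases (fun h => ?_) (fun k h => ?_) k hk
      · exact (i.succAbove_ne j) (by simpa using h.symm)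
      · exact j.succAbove_ne k (i.succAbove_right_injective (by simp at h))
    · rintro ⟨k, hk⟩
      exact i.succAbove_ne _ hk
  refine ⟨Equiv.ofBijective f (Finite.injective_iff_bijective.1 hinj), fun x => ?_⟩
  rw [pick_one_zero]
  have h1 : (1 : Fin (n + 2)) = Fin.succ 0 := rfl
  simp only [Equiv.ofBijective_apply, h1, hf, Fin.cons_succ, Fin.cons_zero]
  rfl

/-- Against a symmetric function all terms of the pair creation operator contribute equally. -/
theorem inner_createTerm_eq {n : ℕ} (η : Kernel) (i : Fin (n + 2)) (j : Fin (n + 1)) (ψ : L2 n)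
    (φ : L2s (n + 2)) :
    inner ℂ (createTerm η i j ψ) (φ : L2 (n + 2)) =
      inner ℂ (createTerm η 1 0 ψ) (φ : L2 (n + 2)) := by
  obtain ⟨σ, hσ⟩ := exists_perm_pick i j
  set U := Lp.compMeasurePreservingₗᵢ (p := 2) (E := ℂ) ℂ _ (measurePreserving_perm σ) with hU
  have hcoe : ∀ ψ : L2 (n + 2), U ψ = Lp.compMeasurePreserving _ (measurePreserving_perm σ) ψ :=
    fun _ => rfl
  have e1 : U (createTerm η 1 0 ψ) = createTerm η i j ψ := by
    rw [hcoe]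
    refine Lp.ext ?_
    filter_upwards [Lp.coeFn_compMeasurePreserving (createTerm η 1 0 ψ) (measurePreserving_perm σ),
      coeFn_createTerm η i j ψ,
      (measurePreserving_perm σ).quasiMeasurePreserving.ae (coeFn_createTerm η 1 0 ψ)]
      with x h1 h2 h3
    have h4 := hσ x
    simp only [pick, Prod.mk.injEq] at h4
    rw [h1, h2, Function.comp_apply, h3, h4.1.1, h4.1.2, h4.2]
  have e2 : U (φ : L2 (n + 2)) = φ := by
    rw [hcoe]
    refine Lp.ext ?_
    filter_upwards [Lp.coeFn_compMeasurePreserving (φ : L2 (n + 2)) (measurePreserving_perm σ),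
      φ.2 σ] with x h1 h2
    rw [h1, Function.comp_apply, h2]
  -- `U` is an isometry that fixes the symmetric function `φ`.
  rw [← e1]
  conv_lhs => rw [← e2]
  exact U.inner_map_map _ _

/-- Fubini's theorem: the term that creates the pair at the places `1` and `0`, as `join` does, is
adjoint to the contraction with the kernel. -/
theorem inner_createTerm_one_zero {n : ℕ} (η : Kernel) (ψ : L2 n) (φ : L2 (n + 2)) :
    inner ℂ (createTerm η 1 0 ψ) φ = inner ℂ ψ (contractL2 η n φ) := by
  have hpj : ∀ q : (Fin n → Pt) × (Pt × Pt), pick 1 0 (join q) = (q.2, q.1) := by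
    rintro ⟨z, x, y⟩
    rw [pick_one_zero]
    rfl
  have hJ := measurePreserving_join (n := n)
  set F : (Fin (n + 2) → Pt) → ℂ := fun x => inner ℂ (createTerm η 1 0 ψ x) (φ x) with hF
  have hFi : Integrable F volume := L2.integrable_inner _ _
  have hFJ : (fun q => F (join q)) =ᵐ[volume]
      fun q : (Fin n → Pt) × (Pt × Pt) => inner ℂ (ψ q.1) (conj (η q.2) * φ (join q)) := by
    filter_upwards [hJ.quasiMeasurePreserving.ae (coeFn_createTerm η 1 0 ψ)] with q hq
    have h4 := hpj q
    simp only [pick, Prod.ext_iff] at h4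
    simp only [hF, hq]
    rw [show ((join q 1, join q ((1 : Fin (n + 2)).succAbove 0)) : Pt × Pt) = q.2 from
      Prod.ext h4.1.1 h4.1.2, h4.2]
    simp only [RCLike.inner_apply, map_mul]
    ring
  have hI : Integrable (fun q : (Fin n → Pt) × (Pt × Pt) =>
      inner ℂ (ψ q.1) (conj (η q.2) * φ (join q))) volume :=
    (hJ.integrable_comp_of_integrable hFi).congr hFJ
  have hFm : ∫ x, F x = ∫ q, F (join q) := by
    conv_lhs => rw [← hJ.map_eq]
    exact integral_map hJ.aemeasurable (by rw [hJ.map_eq]; exact hFi.aestronglyMeasurable)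
  rw [L2.inner_def, L2.inner_def]
  refine hFm.trans ?_
  rw [integral_congr_ae hFJ, Measure.volume_eq_prod, integral_prod _ hI]
  refine integral_congr_ae ?_
  filter_upwards [coeFn_contractL2 η n φ] with z hz
  rw [hz]
  simp only [RCLike.inner_apply]
  rw [integral_mul_const]

/-- On symmetric functions, pair annihilation is adjoint to pair creation. -/
theorem inner_create_left {n : ℕ} (η : Kernel) (ψ : L2s n) (φ : L2s (n + 2)) :
    inner ℂ (create η n ψ) φ = inner ℂ ψ (annihilate η n φ) := by
  have e1 : inner ℂ (create η n ψ) φ = inner ℂ (createL2 η n (ψ : L2 n)) (φ : L2 (n + 2)) := rfl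
  have e2 : inner ℂ ψ (annihilate η n φ) = ((√(n + 1 : ℝ) * √(n + 2 : ℝ) : ℝ) : ℂ) *
      inner ℂ (ψ : L2 n) (contractL2 η n (φ : L2 (n + 2))) := by
    rw [← inner_smul_right]; rfl
  have e : createL2 η n (ψ : L2 n) = (((√(n + 2 : ℝ))⁻¹ * (√(n + 1 : ℝ))⁻¹ : ℝ) : ℂ) •
    (∑ i : Fin (n + 2), ∑ j : Fin (n + 1), createTerm η i j (ψ : L2 n)) := by
      simp [createL2]
  have hs : ((√(n + 2 : ℝ))⁻¹ * (√(n + 1 : ℝ))⁻¹) * ((n + 2) * (n + 1)) =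
      √(n + 1 : ℝ) * √(n + 2 : ℝ) := by
    have h2 : (√(n + 2 : ℝ)) * √(n + 2 : ℝ) = n + 2 := Real.mul_self_sqrt (by positivity)
    have h1 : (√(n + 1 : ℝ)) * √(n + 1 : ℝ) = n + 1 := Real.mul_self_sqrt (by positivity)
    have p2 : 0 < √(n + 2 : ℝ) := by positivity
    have p1 : 0 < √(n + 1 : ℝ) := by positivity
    calc _ = ((√(n + 2 : ℝ))⁻¹ * (√(n + 1 : ℝ))⁻¹) *
          ((√(n + 2 : ℝ) * √(n + 2 : ℝ)) * (√(n + 1 : ℝ) * √(n + 1 : ℝ))) := by rw [h2, h1]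
      _ = _ := by field_simp
  rw [e1, e2, e, inner_smul_left, Complex.conj_ofReal, sum_inner]
  simp only [sum_inner, inner_createTerm_eq η _ _ (ψ : L2 n) φ, inner_createTerm_one_zero]
  simp only [Finset.sum_const, Finset.card_univ, Fintype.card_fin, nsmul_eq_mul]
  rw [← hs]
  push_cast
  ring

/-! ### Grönwall's inequality for a conjugated operator -/

/-- An operator Grönwall inequality: if `B` is antisymmetric, `W` is symmetric and the quadratic form
of the commutator `[W, B]` is at most `K` times that of `W`, then conjugation with `e^B` increases `W`
at most by the factor `e^K`. -/
theorem conj_exp_le_of_re_inner_le {H : Type*} [NormedAddCommGroup H] [InnerProductSpace ℂ H]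
    [CompleteSpace H] {W B : H →L[ℂ] H} {K : ℝ}
    (hW : ∀ u v : H, inner ℂ (W u) v = inner ℂ u (W v))
    (hB : ∀ u v : H, inner ℂ (B u) v = -inner ℂ u (B v))
    (h : ∀ u : H, 2 * (inner ℂ (W u) (B u)).re ≤ K * (inner ℂ (W u) u).re) :
    NormedSpace.exp (-B) * W * NormedSpace.exp B ≤ ((Real.exp K : ℝ) : ℂ) • W := by
  have hadj : ContinuousLinearMap.adjoint B = -B := by
    symm
    rw [ContinuousLinearMap.eq_adjoint_iff]
    intro u v
    rw [neg_apply, inner_neg_left, hB, neg_neg]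
  have hexp : ∀ u v : H, inner ℂ (NormedSpace.exp (-B) u) v =
      inner ℂ u (NormedSpace.exp B v) := by
    have : NormedSpace.exp (-B) = ContinuousLinearMap.adjoint (NormedSpace.exp B) := by
      rw [← ContinuousLinearMap.star_eq_adjoint, NormedSpace.star_exp,
        ContinuousLinearMap.star_eq_adjoint, hadj]
    intro u v
    rw [this, ContinuousLinearMap.adjoint_inner_left]
  have hexp' : ∀ u v : H, inner ℂ (NormedSpace.exp B u) v =
      inner ℂ u (NormedSpace.exp (-B) v) := by
    intro u v
    rw [← inner_conj_symm, ← hexp, inner_conj_symm]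
  rw [ContinuousLinearMap.le_def, ContinuousLinearMap.isPositive_def]
  constructor
  · intro u v
    simp only [ContinuousLinearMap.coe_coe, sub_apply, smul_apply, inner_sub_left, inner_sub_right,
      inner_smul_left, inner_smul_right, Complex.conj_ofReal, hW, mul_apply_eq_comp,
      hexp, hexp']
  intro Ψ
  set u : ℝ → H := fun s => NormedSpace.exp (s • B) Ψ with hu
  have hderiv : ∀ s, HasDerivAt u (B (u s)) s := by
    intro s
    have h1 := (hasDerivAt_exp_smul_const' (𝕂 := ℝ) B s)
    exact ((ContinuousLinearMap.apply ℂ H Ψ).restrictScalars ℝ).hasFDerivAt.comp_hasDerivAt s h1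
  set f : ℝ → ℝ := fun s => (inner ℂ (W (u s)) (u s)).re with hf
  have hfd : ∀ s, HasDerivAt f (2 * (inner ℂ (W (u s)) (B (u s))).re) s := by
    intro s
    have h1 : HasDerivAt (fun s => W (u s)) (W (B (u s))) s :=
      (W.restrictScalars ℝ).hasFDerivAt.comp_hasDerivAt s (hderiv s)
    have h2 := Complex.reCLM.hasFDerivAt.comp_hasDerivAt s (h1.inner ℂ (hderiv s))
    refine h2.congr_deriv ?_
    have : (inner ℂ (W (B (u s))) (u s)).re = (inner ℂ (W (u s)) (B (u s))).re := by
      rw [hW, ← inner_conj_symm, Complex.conj_re]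
    simp only [Complex.reCLM_apply, Complex.add_re, this]
    ring
  -- By hypothesis `f' ≤ K f`, so `e^{-Ks} f(s)` is nonincreasing on `[0, 1]`.
  have hanti : Antitone fun s => Real.exp (-(K * s)) * f s := by
    have hd : ∀ s, HasDerivAt (fun s => Real.exp (-(K * s)) * f s)
        (Real.exp (-(K * s)) * (-K) * f s +
          Real.exp (-(K * s)) * (2 * (inner ℂ (W (u s)) (B (u s))).re)) s := by
      intro s
      have h1 : HasDerivAt (fun s : ℝ => -(K * s)) (-K) s := by
        exact ((hasDerivAt_id s).const_mul K).neg.congr_deriv (by simp)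
      exact h1.exp.mul (hfd s)
    refine antitone_of_deriv_nonpos (fun s => (hd s).differentiableAt) fun s => ?_
    rw [(hd s).deriv]
    have h3 := mul_le_mul_of_nonneg_left (h (u s)) (Real.exp_pos (-(K * s))).le
    simp only [hf]
    linarith
  have h01 := hanti zero_le_one
  have hu0 : u 0 = Ψ := by simp [hu]
  have hu1 : u 1 = NormedSpace.exp B Ψ := by simp [hu]
  simp only [hf, hu0, hu1, mul_one, mul_zero, neg_zero, Real.exp_zero, one_mul] at h01
  have h4 := mul_le_mul_of_nonneg_left h01 (Real.exp_pos K).le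
  rw [← mul_assoc, ← Real.exp_add, add_neg_cancel, Real.exp_zero, one_mul] at h4
  rw [ContinuousLinearMap.reApplyInnerSelf_apply]
  simp only [sub_apply, smul_apply, inner_sub_left, inner_smul_left, Complex.conj_ofReal,
    mul_apply_eq_comp, hexp, map_sub]
  simp only [RCLike.re_to_complex, Complex.re_ofReal_mul]
  linarith

/-! ### Inner products on the sectors and on Fock space -/

-- Mathlib's lemmas at the concrete spaces: `rw` and `simp` do not unfold the instances on `L2s n` and
-- `FockLE N` far enough to apply the general versions.

theorem L2s.inner_smul_left {n : ℕ} (c : ℂ) (ψ φ : L2s n) :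
    inner ℂ (c • ψ) φ = conj c * inner ℂ ψ φ := _root_.inner_smul_left ψ φ c

theorem L2s.inner_smul_right {n : ℕ} (c : ℂ) (ψ φ : L2s n) :
    inner ℂ ψ (c • φ) = c * inner ℂ ψ φ := _root_.inner_smul_right ψ φ c

theorem L2s.inner_conj_symm {n : ℕ} (ψ φ : L2s n) : conj (inner ℂ φ ψ) = inner ℂ ψ φ :=
  _root_.inner_conj_symm ψ φ

theorem L2s.inner_zero_right {n : ℕ} (ψ : L2s n) : inner ℂ ψ (0 : L2s n) = 0 :=
  _root_.inner_zero_right ψ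

theorem L2s.re_inner_self {n : ℕ} (ψ : L2s n) : (inner ℂ ψ ψ).re = ‖ψ‖ ^ 2 :=
  inner_self_eq_norm_sq (𝕜 := ℂ) ψ

theorem FockLE.inner_smul_left {N : ℕ} (c : ℂ) (u v : FockLE N) :
    inner ℂ (c • u) v = conj c * inner ℂ u v := _root_.inner_smul_left u v c

theorem FockLE.inner_smul_right {N : ℕ} (c : ℂ) (u v : FockLE N) :
    inner ℂ u (c • v) = c * inner ℂ u v := _root_.inner_smul_right u v c

theorem FockLE.inner_sub_left {N : ℕ} (u v w : FockLE N) :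
    inner ℂ (u - v) w = inner ℂ u w - inner ℂ v w := _root_.inner_sub_left u v w

theorem FockLE.inner_sub_right {N : ℕ} (u v w : FockLE N) :
    inner ℂ u (v - w) = inner ℂ u v - inner ℂ u w := _root_.inner_sub_right u v w

theorem FockLE.inner_conj_symm {N : ℕ} (u v : FockLE N) : conj (inner ℂ v u) = inner ℂ u v :=
  _root_.inner_conj_symm u v

/-! ### The commutator of the weight with the Bogoliubov generator -/

theorem sector_numWeight {N n : ℕ} (n₁ n₂ : ℤ) (hn : n ≤ N) (u : FockLE N) :
    sector n hn (numWeight N n₁ n₂ u) = ((weight N n₁ n₂ n : ℝ) : ℂ) • sector n hn u := by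
  have e : sector n hn (numWeight N n₁ n₂ u) =
      (((n : ℝ) + 1) ^ n₁ : ℝ) • ((((N : ℝ) + 1 - n) ^ n₂ : ℝ)  • sector n hn u) := rfl
  rw [e, smul_smul]
  rfl

theorem inner_eq_sum_sector {N : ℕ} (u v : FockLE N) :
    inner ℂ u v = ∑ n : Fin (N + 1), inner ℂ (sector (n : ℕ) (Nat.le_of_lt_succ n.2) u)
      (sector (n : ℕ) (Nat.le_of_lt_succ n.2) v) :=
  PiLp.inner_apply u v

theorem inner_numWeight_left {N : ℕ} (n₁ n₂ : ℤ) (u v : FockLE N) :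
    inner ℂ (numWeight N n₁ n₂ u) v = inner ℂ u (numWeight N n₁ n₂ v) := by
  simp only [inner_eq_sum_sector, sector_numWeight, L2s.inner_smul_left, L2s.inner_smul_right,
    Complex.conj_ofReal]

theorem re_inner_numWeight_self {N : ℕ} (n₁ n₂ : ℤ) (u : FockLE N) :
    (inner ℂ (numWeight N n₁ n₂ u) u).re =
      ∑ n : Fin (N + 1), weight N n₁ n₂ n * ‖sector (n : ℕ) (Nat.le_of_lt_succ n.2) u‖ ^ 2 := by
  simp only [inner_eq_sum_sector, sector_numWeight, L2s.inner_smul_left, Complex.conj_ofReal,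
    Complex.re_sum, Complex.re_ofReal_mul]
  refine Finset.sum_congr rfl fun n _ => ?_
  rw [L2s.re_inner_self]

theorem inner_pairCreate {M : ℕ} (η : Kernel) (u v : FockLE (M + 1)) :
    inner ℂ u (pairCreate (M + 1) η v) = ∑ n : Fin M, ((truncFactor (M + 1) n : ℝ) : ℂ) *
      inner ℂ (sector ((n : ℕ) + 2) (by omega) u)
        (create η n (sector (n : ℕ) (by omega) v)) := by
  rw [inner_eq_sum_sector, Fin.sum_univ_succ, Fin.sum_univ_succ]
  have h0 : sector (N := M + 1) 0 (by omega) (pairCreate (M + 1) η v) = 0 := rfl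
  have h1 : sector (N := M + 1) 1 (by omega) (pairCreate (M + 1) η v) = 0 := rfl
  have h2 : ∀ n : Fin M, sector ((n : ℕ) + 2) (by omega) (pairCreate (M + 1) η v) =
      ((truncFactor (M + 1) n : ℝ) : ℂ) • create η n (sector (n : ℕ) (by omega) v) :=
    fun _ => rfl
  simp only [← L2s.inner_smul_right, ← h2]
  change inner ℂ (sector (N := M + 1) 0 (by omega) u)
      (sector (N := M + 1) 0 (by omega) (pairCreate (M + 1) η v)) +
    (inner ℂ (sector (N := M + 1) 1 (by omega) u)
      (sector (N := M + 1) 1 (by omega) (pairCreate (M + 1) η v)) + _) = _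
  rw [h0, h1, L2s.inner_zero_right, L2s.inner_zero_right, zero_add, zero_add]
  rfl

theorem inner_pairAnnihilate {M : ℕ} (η : Kernel) (u v : FockLE (M + 1)) :
    inner ℂ u (pairAnnihilate (M + 1) η v) = ∑ n : Fin M, ((truncFactor (M + 1) n : ℝ) : ℂ) *
      inner ℂ (sector (n : ℕ) (by omega) u)
        (annihilate η n (sector ((n : ℕ) + 2) (by omega) v)) := by
  have hs : ∀ (n : ℕ) (hn : n ≤ M + 1), sector n hn (pairAnnihilate (M + 1) η v) =
      pairAnnihilateComponent η n v := fun _ _ => rfl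
  have h0 : ∀ n : ℕ, M ≤ n → pairAnnihilateComponent η n v = 0 := by
    intro n hn
    rw [pairAnnihilateComponent, dif_neg (by omega)]
    rfl
  have h2 : ∀ n : Fin M, pairAnnihilateComponent η n v =
      ((truncFactor (M + 1) n : ℝ) : ℂ) •
        annihilate η n (sector ((n : ℕ) + 2) (by omega) v) := by
    intro n
    rw [pairAnnihilateComponent, dif_pos (by omega)]
    simp only [mul_comm (√(((M + 1 : ℕ) - (n : ℕ) : ℝ) / (M + 1 : ℕ)))]
    rfl
  rw [inner_eq_sum_sector, Fin.sum_univ_castSucc, Fin.sum_univ_castSucc]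
  simp only [← L2s.inner_smul_right, ← h2, hs]
  rw [h0 _ (by simp), h0 _ (by simp), L2s.inner_zero_right, L2s.inner_zero_right, add_zero, add_zero]
  rfl

theorem inner_pairCreate_left {M : ℕ} (η : Kernel) (u v : FockLE (M + 1)) :
    inner ℂ (pairCreate (M + 1) η u) v = inner ℂ u (pairAnnihilate (M + 1) η v) := by
  rw [← FockLE.inner_conj_symm, inner_pairCreate, inner_pairAnnihilate, map_sum]
  refine Finset.sum_congr rfl fun n _ => ?_
  rw [map_mul, Complex.conj_ofReal, L2s.inner_conj_symm, inner_create_left]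

theorem inner_bogB_left {M : ℕ} (η : Kernel) (u v : FockLE (M + 1)) :
    inner ℂ (bogB (M + 1) η u) v = -inner ℂ u (bogB (M + 1) η v) := by
  have h : inner ℂ (pairAnnihilate (M + 1) η u) v = inner ℂ u (pairCreate (M + 1) η v) := by
    rw [← FockLE.inner_conj_symm, ← inner_pairCreate_left, FockLE.inner_conj_symm]
  simp only [bogB, smul_apply, sub_apply, FockLE.inner_smul_left, FockLE.inner_smul_right, FockLE.inner_sub_left,
    FockLE.inner_sub_right, inner_pairCreate_left, h]
  have : conj (1 / 2 : ℂ) = 1 / 2 := by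
    rw [map_div₀, map_one, Complex.conj_ofNat]
  rw [this]
  ring

/-- The expectation of the commutator of `(𝒩+1)^{n₁} (N+1-𝒩)^{n₂}` and `B(η)`. As `B(η)` changes the
particle number by `±2`, the commutator sees only differences of weights two sectors apart. -/
theorem two_mul_re_inner_bogB {M : ℕ} (n₁ n₂ : ℤ) (η : Kernel) (u : FockLE (M + 1)) :
    2 * (inner ℂ (numWeight (M + 1) n₁ n₂ u) (bogB (M + 1) η u)).re =
      ∑ n : Fin M, (weight (M + 1) n₁ n₂ (n + 2) - weight (M + 1) n₁ n₂ n) *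
        truncFactor (M + 1) n * (inner ℂ (sector ((n : ℕ) + 2) (by omega) u)
          (create η n (sector (n : ℕ) (by omega) u))).re := by
  have e : inner ℂ (numWeight (M + 1) n₁ n₂ u) (bogB (M + 1) η u) =
      ((1 / 2 : ℝ) : ℂ) * (inner ℂ (numWeight (M + 1) n₁ n₂ u) (pairCreate (M + 1) η u) -
        inner ℂ (numWeight (M + 1) n₁ n₂ u) (pairAnnihilate (M + 1) η u)) := by
    rw [← FockLE.inner_sub_right, ← FockLE.inner_smul_right]
    simp [bogB]
  rw [e, Complex.re_ofReal_mul, inner_pairCreate, inner_pairAnnihilate, ← Finset.sum_sub_distrib,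
    ← mul_assoc, mul_one_div_cancel two_ne_zero, one_mul, Complex.re_sum]
  refine Finset.sum_congr rfl fun n _ => ?_
  rw [sector_numWeight, sector_numWeight, L2s.inner_smul_left, L2s.inner_smul_left, Complex.conj_ofReal,
    Complex.conj_ofReal, ← inner_create_left,
    ← L2s.inner_conj_symm (create η n (sector (n : ℕ) (by omega) u)), Complex.sub_re,
    Complex.re_ofReal_mul, Complex.re_ofReal_mul, Complex.re_ofReal_mul, Complex.re_ofReal_mul,
    Complex.conj_re]
  ring

theorem sum_weight_le {M : ℕ} (n₁ n₂ : ℤ) (u : FockLE (M + 1)) :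
    ∑ n : Fin M, weight (M + 1) n₁ n₂ n * ‖sector (n : ℕ) (by omega) u‖ ^ 2 ≤
      (inner ℂ (numWeight (M + 1) n₁ n₂ u) u).re := by
  rw [re_inner_numWeight_self, Fin.sum_univ_castSucc, Fin.sum_univ_castSucc]
  refine (le_add_of_nonneg_right ?_).trans (le_add_of_nonneg_right ?_) <;>
  exact mul_nonneg (weight_pos _ _ (by simp)).le (by positivity)

theorem sum_weight_add_two_le {M : ℕ} (n₁ n₂ : ℤ) (u : FockLE (M + 1)) :
    ∑ n : Fin M, weight (M + 1) n₁ n₂ (n + 2) * ‖sector ((n : ℕ) + 2) (by omega) u‖ ^ 2 ≤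
      (inner ℂ (numWeight (M + 1) n₁ n₂ u) u).re := by
  rw [re_inner_numWeight_self, Fin.sum_univ_succ, Fin.sum_univ_succ]
  refine (le_add_of_nonneg_left ?_).trans (le_add_of_nonneg_left ?_) <;>
  exact mul_nonneg (weight_pos _ _ (by simp)).le (by positivity)

/-- The commutator of `B(η)` with a weight is bounded by the weight, uniformly in `N`. -/
theorem exists_two_mul_re_inner_bogB_le (n₁ n₂ : ℤ) :
    ∃ K : ℝ, ∀ (M : ℕ) (η : Kernel) (u : FockLE (M + 1)),
      2 * (inner ℂ (numWeight (M + 1) n₁ n₂ u) (bogB (M + 1) η u)).re ≤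
        K * ‖η‖ * (inner ℂ (numWeight (M + 1) n₁ n₂ u) u).re := by
  obtain ⟨K, hK, h⟩ := exists_abs_weight_sub_mul_pairBound_le n₁ n₂
  refine ⟨K, fun M η u => ?_⟩
  rw [two_mul_re_inner_bogB]
  have hterm : ∀ n : Fin M, (weight (M + 1) n₁ n₂ (n + 2) - weight (M + 1) n₁ n₂ n) *
      truncFactor (M + 1) n * (inner ℂ (sector ((n : ℕ) + 2) (by omega) u)
        (create η n (sector (n : ℕ) (by omega) u))).re ≤
      K * ‖η‖ / 2 * (weight (M + 1) n₁ n₂ n * ‖sector (n : ℕ) (by omega) u‖ ^ 2) +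
      K * ‖η‖ / 2 *
        (weight (M + 1) n₁ n₂ (n + 2) * ‖sector ((n : ℕ) + 2) (by omega) u‖ ^ 2) := by
    intro n
    obtain ⟨h1, h2⟩ := h (M + 1) n (by omega)
    set a := sector (n : ℕ) (by omega) u
    set b := sector ((n : ℕ) + 2) (by omega) u
    set D := weight (M + 1) n₁ n₂ (n + 2) - weight (M + 1) n₁ n₂ n
    have hin : |(inner ℂ b (create η n a)).re| ≤
        ‖b‖ * (√((n : ℕ) + 2 : ℝ) * √((n : ℕ) + 1 : ℝ) * ‖η‖ * ‖a‖) :=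
      (Complex.abs_re_le_norm _).trans ((norm_inner_le_norm _ _).trans
        (mul_le_mul_of_nonneg_left (norm_create_le η n a) (norm_nonneg _)))
    have hP := pairBound_nonneg (M + 1) n
    have ht := truncFactor_nonneg (M + 1) n
    calc _ ≤ |D * truncFactor (M + 1) n * (inner ℂ b (create η n a)).re| := le_abs_self _
      _ = |D| * truncFactor (M + 1) n * |(inner ℂ b (create η n a)).re| := by
        rw [abs_mul, abs_mul, abs_of_nonneg ht]
      _ ≤ |D| * truncFactor (M + 1) n *
          (‖b‖ * (√((n : ℕ) + 2 : ℝ) * √((n : ℕ) + 1 : ℝ) * ‖η‖ * ‖a‖)) := by gcongr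
      _ = (|D| * pairBound (M + 1) n) * ‖η‖ * (‖a‖ * ‖b‖) := by rw [pairBound]; ring
      _ ≤ (|D| * pairBound (M + 1) n) * ‖η‖ * ((‖a‖ ^ 2 + ‖b‖ ^ 2) / 2) := by
        gcongr
        linarith [two_mul_le_add_sq ‖a‖ ‖b‖]
      _ = ‖η‖ / 2 * ‖a‖ ^ 2 * (|D| * pairBound (M + 1) n) +
          ‖η‖ / 2 * ‖b‖ ^ 2 * (|D| * pairBound (M + 1) n) := by ring
      _ ≤ ‖η‖ / 2 * ‖a‖ ^ 2 * (K * weight (M + 1) n₁ n₂ n) +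
          ‖η‖ / 2 * ‖b‖ ^ 2 * (K * weight (M + 1) n₁ n₂ (n + 2)) := by gcongr
      _ = _ := by ring
  refine (Finset.sum_le_sum fun n _ => hterm n).trans ?_
  rw [Finset.sum_add_distrib, ← Finset.mul_sum, ← Finset.mul_sum]
  have hc : 0 ≤ K * ‖η‖ / 2 := by positivity
  have h1 := mul_le_mul_of_nonneg_left (sum_weight_le n₁ n₂ u) hc
  have h2 := mul_le_mul_of_nonneg_left (sum_weight_add_two_le n₁ n₂ u) hc
  linarith

end BogFock

end

theorem mainTheorem7 :
    ∃ C : ℤ → ℤ → ℝ → ℝ, ∀ (n₁ n₂ : ℤ) (N : ℕ), 1 ≤ N → ∀ η : BogFock.Kernel,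
      NormedSpace.exp (-BogFock.bogB N η) * BogFock.numWeight N n₁ n₂ *
          NormedSpace.exp (BogFock.bogB N η) ≤
        ((C n₁ n₂ ‖η‖ : ℝ) : ℂ) • BogFock.numWeight N n₁ n₂ := by
  choose K hK using BogFock.exists_two_mul_re_inner_bogB_le
  refine ⟨fun n₁ n₂ r => Real.exp (K n₁ n₂ * r), fun n₁ n₂ N hN η => ?_⟩
  obtain ⟨M, rfl⟩ : ∃ M, N = M + 1 := ⟨N - 1, by omega⟩
  exact BogFock.conj_exp_le_of_re_inner_le (BogFock.inner_numWeight_left n₁ n₂)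
    (BogFock.inner_bogB_left η) (hK n₁ n₂ M η)
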